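/- **Definitions.** A weighted graph on $n$ vertices is given by a vector $w\in\mathbb{R}_{\ge 0}^{\binom n2}$ of edge weights, where $w_e=0$ means that there is no edge in the slot $e$; $w_{\max}$ and $w_{\min}$ denote its largest and smallest nonzero weights. The length of a path is the sum of its edge weights, and $d_w(u,v)$ is the shortest path length ($\infty$ if there is no path). For $t\ge 1$, a weighted graph $w'$ on the same vertices, whose edges are among those of $w$ (with possibly different weights), is a $t$-spanner of $w$ if $d_w(u,v)\le d_{w'}(u,v)\le t\cdot d_w(u,v)$ for all vertices $u,v$. A linear sketch of $N$ measurements consists of a random matrix $\Phi\in\mathbb{R}^{N\times\binom n2}$ and a randomized recovery algorithm $\mathcal{A}$ that receives $\Phi w$ and outputs a weighted graph on the same vertices; $\mathcal{A}$ may share its randomness with $\Phi$, but depends on $w$ only through $\Phi w$. **Proposition 1.3.** Any linear sketch (not necessarily an incidence sketch) that computes an $o(w_{\max}/w_{\min})$-spanner with probability $\ge 0.9$ on every input must use $N=\Omega(n^2)$ measurements. Precisely: there are absolute constants $\varepsilon>0$, $c>0$ and $n_0$ such that the following holds for every $n\ge n_0$. Let $t:[1,\infty)\to[1,\infty)$ be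 any function with $t(r)\le \varepsilon r$ for all sufficiently large $r$ (in particular, any $t$ with $t(r)=o(r)$ as $r\to\infty$; $t$ may depend on $n$). Suppose that a linear sketch of $N$ measurements outputs, for every $w\in\mathbb{R}_{\ge0}^{\binom n2}$ with $w_{\max}\ge 1\ge w_{\min}$, a $t(w_{\max}/w_{\min})$-spanner of the graph with edge weights $w$ with probability at least $0.9$. Then $N\ge c\,n^2$. -/

import Mathlib

open scoped NNReal ENNReal

/-- The `n choose 2` edge slots on the vertex set `Fin n`: unordered pairs of distinct vertices. -/
abbrev EdgeSlot (n : ℕ) : Type := {e : Sym2 (Fin n) // ¬ e.IsDiag}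

/-- A weighted graph on `n` vertices, given by its vector of nonnegative edge weights;
weight `0` means that there is no edge in the slot. -/
abbrev EdgeWeights (n : ℕ) : Type := EdgeSlot n → ℝ≥0

namespace EdgeWeights

variable {n : ℕ}

/-- The weight of an unordered pair of vertices (`0` on the diagonal). -/
noncomputable def weight (w : EdgeWeights n) (e : Sym2 (Fin n)) : ℝ≥0 :=
  open scoped Classical in if h : e.IsDiag then 0 else w ⟨e, h⟩

/-- The underlying simple graph: `u` and `v` are adjacent when their slot has nonzero weight. -/
def graph (w : EdgeWeights n) : SimpleGraph (Fin n) :=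
  SimpleGraph.fromEdgeSet {e | w.weight e ≠ 0}

/-- Shortest path length: the minimum over all paths from `u` to `v` of the total edge weight
along the path (`⊤` if there is no such path). -/
noncomputable def dist (w : EdgeWeights n) (u v : Fin n) : ℝ≥0∞ :=
  ⨅ p : w.graph.Path u v, (((p : w.graph.Walk u v).edges.map w.weight).sum : ℝ≥0∞)

/-- `h.IsSpanner t w`: the weighted graph `h` is a `t`-spanner of the weighted graph `w`. The edges
of `h` are among those of `w`, but their weights may differ from those in `w`. -/
def IsSpanner (h : EdgeWeights n) (t : ℝ) (w : EdgeWeights n) : Prop :=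
  (∀ e, h e ≠ 0 → w e ≠ 0) ∧
    ∀ u v, w.dist u v ≤ h.dist u v ∧ h.dist u v ≤ ENNReal.ofReal t * w.dist u v

/-- The largest edge weight (`0` for the empty graph). -/
noncomputable def wMax (w : EdgeWeights n) : ℝ≥0 := ⨆ e, w e

/-- The smallest nonzero edge weight (`0` for the empty graph). -/
noncomputable def wMin (w : EdgeWeights n) : ℝ≥0 := ⨅ e : {e // w e ≠ 0}, w e

/-- The weights as a real vector. -/
def toVec (w : EdgeWeights n) : EdgeSlot n → ℝ := fun e => w e

end EdgeWeights

/-- A linear sketch of `N` measurements for weighted graphs on `n` vertices, with randomness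
`ω : Ω`: a random sketching matrix and a randomized recovery algorithm mapping the sketch (a vector
in `ℝ^N`) to a weighted graph. The two may share their randomness arbitrarily; in particular the
recovery algorithm may know the sketching matrix, or use coins independent of it. -/
structure LinearSketch (n N : ℕ) (Ω : Type*) [MeasurableSpace Ω] where
  /-- The random sketching matrix. -/
  matrix : Ω → Matrix (Fin N) (EdgeSlot n) ℝ
  /-- The randomized recovery algorithm. -/
  recover : Ω → (Fin N → ℝ) → EdgeWeights n
  measurable_matrix : ∀ i e, Measurable fun ω => matrix ω i e
  measurable_recover : Measurable fun x : Ω × (Fin N → ℝ) => recover x.1 x.2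

namespace LinearSketch

variable {n N : ℕ} {Ω : Type*} [MeasurableSpace Ω]

/-- The output of the sketch on the input graph `w`. The input is accessed only through the
vector of measurements `Φ w`. -/
def output (S : LinearSketch n N Ω) (w : EdgeWeights n) (ω : Ω) : EdgeWeights n :=
  S.recover ω ((S.matrix ω).mulVec w.toVec)

/-- On every input `w` with `w_max ≥ 1 ≥ w_min`, the sketch outputs a `t (w_max / w_min)`-spanner of
`w` with probability at least `p`. The normalization excludes the empty graph. -/
def ComputesSpanner (S : LinearSketch n N Ω) (P : MeasureTheory.Measure Ω) (t : ℝ → ℝ)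
    (p : ℝ) : Prop :=
  ∀ w : EdgeWeights n, 1 ≤ w.wMax → w.wMin ≤ 1 →
    p ≤ P.real {ω | (S.output w ω).IsSpanner (t (w.wMax / w.wMin)) w}

end LinearSketch

theorem Matrix.exists_mulVec_eq_zero_of_card_lt {ι : Type*} [Fintype ι] [DecidableEq ι] {N : ℕ}
    (Φ : Matrix (Fin N) ι ℝ) (B : Finset ι) (hB : N < B.card) :
    ∃ e ∈ B, ∃ y : ι → ℝ, Φ.mulVec y = 0 ∧ (∀ s ∉ B, y s = 0) ∧ (∀ s, |y s| ≤ 1) ∧ y e = 1 := by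
  have hker := LinearMap.ker_ne_bot_of_finrank_lt
    (f := (Φ.submatrix id (Subtype.val : B → ι)).mulVecLin) (by simpa using hB)
  obtain ⟨z, hz, hz0⟩ := Submodule.exists_mem_ne_zero_of_ne_bot hker
  have hne : Nonempty B := by
    obtain ⟨i, -⟩ := Function.ne_iff.mp hz0
    exact ⟨i⟩
  obtain ⟨e, he⟩ := Finite.exists_max fun s : B => |z s|
  have hze : z e ≠ 0 := by
    intro h
    refine hz0 (funext fun s => ?_)
    have := he s
    rw [h, abs_zero] at this
    exact abs_eq_zero.mp (le_antisymm this (abs_nonneg _))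
  refine ⟨e, e.2, fun s => if h : s ∈ B then z ⟨s, h⟩ / z e else 0, ?_, ?_, ?_, ?_⟩
  · funext i
    have hi : ∑ s : B, Φ i s * z s = 0 := congrFun (LinearMap.mem_ker.mp hz) i
    have : ∑ s : B, Φ i s * (z s / z e) = 0 := by
      simp_rw [← mul_div_assoc, ← Finset.sum_div, hi, zero_div]
    simp only [Matrix.mulVec, dotProduct, Pi.zero_apply, mul_dite, mul_zero]
    rw [← Finset.sum_subset (Finset.subset_univ B)
      (fun s _ hs => dif_neg hs), ← Finset.sum_coe_sort B]
    refine Eq.trans ?_ this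
    exact Finset.sum_congr rfl fun s _ => by simp
  · intro s hs
    simp [hs]
  · intro s
    by_cases h : s ∈ B
    · simp only [h, dite_true, abs_div]
      exact div_le_one_of_le₀ (he ⟨s, h⟩) (abs_nonneg _)
    · simp [h]
  · simp [hze]

namespace EdgeWeights

variable {n : ℕ}

theorem weight_mk (w : EdgeWeights n) (e : EdgeSlot n) : w.weight e.1 = w e := by
  simp [weight, e.2]

theorem graph_adj (w : EdgeWeights n) {u v : Fin n} :
    w.graph.Adj u v ↔ w.weight s(u, v) ≠ 0 := by
  simp only [graph, SimpleGraph.fromEdgeSet_adj, Set.mem_ofPred_eq, and_iff_left_iff_imp]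
  rintro h rfl
  simp [weight] at h

theorem dist_le_weight (w : EdgeWeights n) {u v : Fin n} (h : w.weight s(u, v) ≠ 0) :
    w.dist u v ≤ w.weight s(u, v) :=
  (iInf_le _ (SimpleGraph.Path.singleton (w.graph_adj.mpr h))).trans
    (by simp [SimpleGraph.Path.singleton])

theorem dist_comm_le (w : EdgeWeights n) (u v : Fin n) : w.dist u v ≤ w.dist v u :=
  le_iInf fun p => (iInf_le _ p.reverse).trans (by simp [SimpleGraph.Path.reverse])

theorem le_dist (w : EdgeWeights n) {u v : Fin n} {C : ℝ≥0∞} (huv : u ≠ v)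
    (hC : ∀ c, w.weight s(u, c) ≠ 0 → C ≤ w.weight s(u, c)) : C ≤ w.dist u v := by
  refine le_iInf fun ⟨p, _⟩ => ?_
  cases p with
  | nil => exact absurd rfl huv
  | cons h p =>
    refine (hC _ (w.graph_adj.mp h)).trans ?_
    simp

/-- If all `w`-neighbours of `u` other than `v` are far from `u`, then a `t`-spanner keeps the
edge `uv`. -/
theorem IsSpanner.weight_ne_zero {h w : EdgeWeights n} {t : ℝ} (hs : h.IsSpanner t w)
    {u v : Fin n} {C : ℝ≥0∞} (huv : w.weight s(u, v) ≠ 0)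
    (hC : ∀ c, c ≠ v → w.weight s(u, c) ≠ 0 → C ≤ w.dist u c)
    (ht : ENNReal.ofReal t * w.weight s(u, v) < C) : h.weight s(u, v) ≠ 0 := by
  intro h0
  have hne : u ≠ v := (w.graph_adj.mpr huv).ne
  have hsub : ∀ c, h.weight s(u, c) ≠ 0 → w.weight s(u, c) ≠ 0 := by
    intro c hc
    have hd : ¬ (s(u, c)).IsDiag := fun hd => hc (by simp [weight, hd])
    have := hs.1 ⟨s(u, c), hd⟩
    simp only [← weight_mk] at this
    exact this hc
  have h1 : C ≤ h.dist u v := by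
    refine h.le_dist hne fun c hc => ?_
    have hcv : c ≠ v := by
      rintro rfl
      exact hc h0
    exact ((hC c hcv (hsub c hc)).trans (hs.2 u c).1).trans (h.dist_le_weight hc)
  have h2 : h.dist u v ≤ ENNReal.ofReal t * w.weight s(u, v) :=
    (hs.2 u v).2.trans (mul_le_mul_right (w.dist_le_weight huv) _)
  exact absurd ht (not_lt.mpr (h1.trans h2))

end EdgeWeights

/-- The edge slot joining the vertices `0` and `1`. -/
def lightSlot (k : ℕ) : EdgeSlot (k + 2) := ⟨s(0, 1), by simp⟩

/-- The slots avoiding the vertices `0` and `1`. -/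
def coreSlots (k : ℕ) : Finset (EdgeSlot (k + 2)) :=
  Finset.univ.map
    ⟨fun e : EdgeSlot k => ⟨e.1.map fun v => v.succ.succ, by
        exact (Sym2.isDiag_map ((Fin.succ_injective _).comp (Fin.succ_injective _))).not.mpr e.2⟩,
      fun e f h => Subtype.ext (Sym2.map.injective
        ((Fin.succ_injective _).comp (Fin.succ_injective _)) (congrArg Subtype.val h))⟩

theorem card_coreSlots (k : ℕ) : (coreSlots k).card = k.choose 2 := by
  rw [coreSlots, Finset.card_map, Finset.card_univ, Sym2.card_subtype_not_diag, Fintype.card_fin]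

theorem ne_of_mem_coreSlots {k : ℕ} {e : EdgeSlot (k + 2)} (he : e ∈ coreSlots k)
    {v : Fin (k + 2)} (hv : v ∈ e.1) : v ≠ 0 ∧ v ≠ 1 := by
  simp only [coreSlots, Finset.mem_map, Finset.mem_univ, true_and] at he
  obtain ⟨a, rfl⟩ := he
  obtain ⟨b, -, rfl⟩ := Sym2.mem_map.mp hv
  have hb : b.succ.succ.val = b.val + 2 := rfl
  constructor <;> intro h <;> rw [h] at hb <;> simp at hb

theorem lightSlot_notMem (k : ℕ) : lightSlot k ∉ coreSlots k := fun h =>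
  (ne_of_mem_coreSlots h (v := 0) (by simp [lightSlot])).1 rfl

/-- The graph with weight `x` on the core slots except for weight `b` on `e`, together with an
isolated edge of weight `1`. -/
noncomputable def testGraph {k : ℕ} (e : EdgeSlot (k + 2)) (b : ℝ≥0)
    (x : EdgeSlot (k + 2) → ℝ) : EdgeWeights (k + 2) := fun s =>
  if s = e then b else if s ∈ coreSlots k then (x s).toNNReal
  else if s = lightSlot k then 1 else 0

section testGraph

variable {k : ℕ} {e : EdgeSlot (k + 2)} {b : ℝ≥0} {x : EdgeSlot (k + 2) → ℝ}

theorem testGraph_self : testGraph e b x e = b := by simp [testGraph]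

theorem testGraph_lightSlot (he : e ∈ coreSlots k) : testGraph e b x (lightSlot k) = 1 := by
  have h : lightSlot k ≠ e := fun h => lightSlot_notMem k (h ▸ he)
  simp [testGraph, h, lightSlot_notMem]

theorem testGraph_core {f : EdgeSlot (k + 2)} (hf : f ∈ coreSlots k) (hfe : f ≠ e) :
    testGraph e b x f = (x f).toNNReal := by
  simp [testGraph, hf, hfe]

theorem mem_core_of_testGraph_ne_zero {f : EdgeSlot (k + 2)} (he : e ∈ coreSlots k)
    (h : testGraph e b x f ≠ 0) {v : Fin (k + 2)} (hv : v ∈ f.1) (hv0 : v ≠ 0) (hv1 : v ≠ 1) :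
    f ∈ coreSlots k := by
  by_contra hf
  have hfe : f ≠ e := fun h => hf (h ▸ he)
  have hl : f ≠ lightSlot k := by
    rintro rfl
    simp [lightSlot, hv0, hv1] at hv
  simp [testGraph, hfe, hf, hl] at h

theorem testGraph_wMin_le (he : e ∈ coreSlots k) : (testGraph e b x).wMin ≤ 1 := by
  rw [EdgeWeights.wMin]
  have h := testGraph_lightSlot (b := b) (x := x) he
  exact (ciInf_le (OrderBot.bddBelow _)
    (⟨lightSlot k, by rw [h]; exact one_ne_zero⟩ :
      {f // testGraph e b x f ≠ 0})).trans h.le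

theorem EdgeWeights.le_wMax {n : ℕ} (w : EdgeWeights n) (e : EdgeSlot n) : w e ≤ w.wMax :=
  le_ciSup (Set.finite_range w).bddAbove e

theorem one_le_testGraph_wMax (he : e ∈ coreSlots k) : 1 ≤ (testGraph e b x).wMax :=
  (testGraph_lightSlot he).ge.trans (EdgeWeights.le_wMax _ _)

theorem testGraph_wMin_eq (he : e ∈ coreSlots k) (hx : ∀ f, 1 ≤ x f) :
    (testGraph e 1 x).wMin = 1 := by
  refine le_antisymm (testGraph_wMin_le he) ?_
  have : Nonempty {f // testGraph e 1 x f ≠ 0} :=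
    ⟨⟨lightSlot k, by rw [testGraph_lightSlot he]; exact one_ne_zero⟩⟩
  refine le_ciInf fun ⟨f, hf⟩ => ?_
  have h1 : 1 ≤ (x f).toNNReal := by simpa using hx f
  simp only [testGraph] at hf ⊢
  split_ifs at hf ⊢ <;> simp_all

theorem le_dist_testGraph {L : ℝ} (he : e ∈ coreSlots k) (hx : ∀ f, L ≤ x f)
    {c u : Fin (k + 2)} (huc : c ≠ u) (hce : c ∉ e.1) (hc0 : c ≠ 0) (hc1 : c ≠ 1) :
    ENNReal.ofReal L ≤ (testGraph e b x).dist u c := by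
  refine le_trans ?_ (EdgeWeights.dist_comm_le _ _ _)
  refine EdgeWeights.le_dist _ huc fun d hd => ?_
  have hdiag : ¬ (s(c, d)).IsDiag := fun h => hd (by simp [EdgeWeights.weight, h])
  rw [EdgeWeights.weight_mk _ ⟨s(c, d), hdiag⟩] at hd ⊢
  have hcore := mem_core_of_testGraph_ne_zero he hd (Sym2.mem_mk_left c d) hc0 hc1
  rw [testGraph_core hcore]
  · exact ENNReal.ofReal_le_ofReal (hx _)
  · rintro rfl
    exact hce (Sym2.mem_mk_left c d)

theorem EdgeWeights.IsSpanner.testGraph_one_ne_zero {L t : ℝ} (he : e ∈ coreSlots k)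
    (hx : ∀ f, L ≤ x f) (htL : t < L) (hL : 0 < L) {h : EdgeWeights (k + 2)}
    (hs : h.IsSpanner t (testGraph e 1 x)) :
    h e ≠ 0 := by
  obtain ⟨e, hd⟩ := e
  induction e using Sym2.ind with
  | _ u v =>
  have hw : (testGraph ⟨s(u, v), hd⟩ 1 x).weight s(u, v) = 1 := by
    rw [EdgeWeights.weight_mk _ ⟨s(u, v), hd⟩, testGraph_self]
  rw [← EdgeWeights.weight_mk h]
  refine hs.weight_ne_zero (C := ENNReal.ofReal L) (by rw [hw]; exact one_ne_zero) ?_ ?_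
  · intro c hcv hc
    have hu := ne_of_mem_coreSlots he (Sym2.mem_mk_left u v)
    have hdiag : ¬ (s(u, c)).IsDiag := fun h => hc (by simp [EdgeWeights.weight, h])
    rw [EdgeWeights.weight_mk _ ⟨s(u, c), hdiag⟩] at hc
    have hcore := mem_core_of_testGraph_ne_zero he hc (Sym2.mem_mk_left u c) hu.1 hu.2
    have hc' := ne_of_mem_coreSlots hcore (Sym2.mem_mk_right u c)
    have hcu : c ≠ u := fun h => hdiag (by simp [h])
    exact le_dist_testGraph he hx hcu (by simp [hcu, hcv]) hc'.1 hc'.2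
  · rw [hw, ENNReal.coe_one, mul_one]
    exact (ENNReal.ofReal_lt_ofReal_iff hL).mpr htL

theorem EdgeWeights.IsSpanner.testGraph_zero_eq_zero {t : ℝ} {h : EdgeWeights (k + 2)}
    (hs : h.IsSpanner t (testGraph e 0 x)) : h e = 0 := by
  by_contra h0
  exact hs.1 e h0 testGraph_self

theorem testGraph_wMax_mem {L U : ℝ} (hcard : 1 < (coreSlots k).card)
    (hL : ∀ f, L ≤ x f) (hU : ∀ f, x f ≤ U) (h1 : 1 ≤ U) :
    L ≤ (testGraph e 1 x).wMax ∧ (testGraph e 1 x).wMax ≤ U := by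
  constructor
  · obtain ⟨f, hf, hfe⟩ := Finset.exists_mem_ne hcard e
    have h2 := EdgeWeights.le_wMax (testGraph e 1 x) f
    rw [testGraph_core hf hfe] at h2
    exact ((hL f).trans (Real.le_coe_toNNReal _)).trans (NNReal.coe_le_coe.mpr h2)
  · have : Nonempty (EdgeSlot (k + 2)) := ⟨e⟩
    have hU0 : 0 ≤ U := by linarith
    have : (testGraph e 1 x).wMax ≤ U.toNNReal := by
      refine ciSup_le fun f => ?_
      have := Real.toNNReal_le_toNNReal (hU f)
      have h1' : 1 ≤ U.toNNReal := by simpa using h1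
      simp only [testGraph]
      split_ifs <;> simp_all
    have := NNReal.coe_le_coe.mpr this
    rwa [Real.coe_toNNReal _ hU0] at this

theorem testGraph_one_eq_sub {y : EdgeSlot (k + 2) → ℝ}
    (hy : ∀ s ∉ coreSlots k, y s = 0) (hye : y e = 1)
    (hx : ∀ f, 0 ≤ x f) (hxy : ∀ f, 0 ≤ x f - y f) :
    (testGraph e 1 x).toVec = (testGraph e 0 (x - y)).toVec + y := by
  funext s
  simp only [EdgeWeights.toVec, Pi.add_apply, testGraph]
  by_cases hse : s = e
  · simp [hse, hye]
  by_cases hs : s ∈ coreSlots k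
  · simp [hse, hs, hx, hxy]
  · simp only [hse, hs, hy s hs, if_false, add_zero]

end testGraph

namespace LinearSketch

open MeasureTheory

variable {k N : ℕ} {Ω : Type*} [MeasurableSpace Ω]

/-- The pairs of randomness and weights for which the output on the test graph contains `e`. -/
def detectSet (S : LinearSketch (k + 2) N Ω) (e : EdgeSlot (k + 2)) (b : ℝ≥0) :
    Set (Ω × (EdgeSlot (k + 2) → ℝ)) :=
  {p | S.output (testGraph e b p.2) p.1 e ≠ 0}

theorem measurableSet_detectSet (S : LinearSketch (k + 2) N Ω) (e : EdgeSlot (k + 2)) (b : ℝ≥0) :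
    MeasurableSet (S.detectSet e b) := by
  have hvec : ∀ s, Measurable fun x : EdgeSlot (k + 2) → ℝ => (testGraph e b x).toVec s := by
    intro s
    simp only [EdgeWeights.toVec, testGraph]
    split_ifs <;> fun_prop
  have hmul : Measurable fun p : Ω × (EdgeSlot (k + 2) → ℝ) =>
      (S.matrix p.1).mulVec (testGraph e b p.2).toVec := by
    refine measurable_pi_lambda _ fun i => ?_
    simp only [Matrix.mulVec, dotProduct]
    exact Finset.measurable_sum _ fun s _ =>
      ((S.measurable_matrix i s).comp measurable_fst).mul ((hvec s).comp measurable_snd)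
  have hout : Measurable fun p : Ω × (EdgeSlot (k + 2) → ℝ) =>
      S.output (testGraph e b p.2) p.1 e :=
    (measurable_pi_apply e).comp
      (S.measurable_recover.comp (measurable_fst.prodMk hmul))
  exact (measurableSet_singleton (0 : ℝ≥0)).compl.preimage hout

theorem output_one_eq_output_zero (S : LinearSketch (k + 2) N Ω) {e : EdgeSlot (k + 2)} {ω : Ω}
    {x y : EdgeSlot (k + 2) → ℝ} (hker : (S.matrix ω).mulVec y = 0)
    (hy : ∀ s ∉ coreSlots k, y s = 0) (hye : y e = 1)
    (hx : ∀ f, 0 ≤ x f) (hxy : ∀ f, 0 ≤ x f - y f) :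
    S.output (testGraph e 1 x) ω = S.output (testGraph e 0 (x - y)) ω := by
  rw [output, output, testGraph_one_eq_sub hy hye hx hxy, Matrix.mulVec_add, hker, add_zero]

/-- The cube `[a, b]` in the space of weight vectors. -/
abbrev cube (k : ℕ) (a b : ℝ) : Set (EdgeSlot (k + 2) → ℝ) :=
  Set.Icc (fun _ => a) (fun _ => b)

theorem volume_cube (k : ℕ) (a b : ℝ) :
    volume (cube k a b) = ENNReal.ofReal (b - a) ^ Fintype.card (EdgeSlot (k + 2)) := by
  rw [Real.volume_Icc_pi, Finset.prod_const, Finset.card_univ]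

/-- For all but `N` of the core slots, the presence of `e` is detected on an enlarged cube without
`e` at least as often as on the cube with `e`. -/
theorem sum_volume_detect_le (S : LinearSketch (k + 2) N Ω) (ω : Ω) {a b : ℝ} (ha : 1 ≤ a) :
    ∑ e ∈ coreSlots k, volume.restrict (cube k a b) (Prod.mk ω ⁻¹' S.detectSet e 1) ≤
      (∑ e ∈ coreSlots k,
        volume.restrict (cube k (a - 1) (b + 1)) (Prod.mk ω ⁻¹' S.detectSet e 0)) +
      N * volume (cube k a b) := by
  classical
  set f : EdgeSlot (k + 2) → ℝ≥0∞ := fun e =>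
    volume.restrict (cube k a b) (Prod.mk ω ⁻¹' S.detectSet e 1)
  set g : EdgeSlot (k + 2) → ℝ≥0∞ := fun e =>
    volume.restrict (cube k (a - 1) (b + 1)) (Prod.mk ω ⁻¹' S.detectSet e 0)
  have hf : ∀ e, f e ≤ volume (cube k a b) := fun e =>
    (measure_mono (Set.subset_univ _)).trans (by simp)
  have hbad : ((coreSlots k).filter fun e => ¬ f e ≤ g e).card ≤ N := by
    by_contra hlt
    rw [not_le] at hlt
    obtain ⟨e, he, y, hker, hy, hy1, hye⟩ :=
      (S.matrix ω).exists_mulVec_eq_zero_of_card_lt _ hlt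
    refine (Finset.mem_filter.mp he).2 ?_
    have hcore : ∀ s ∉ coreSlots k, y s = 0 := fun s hs =>
      hy s fun h => hs (Finset.mem_filter.mp h).1
    have hm : ∀ c, MeasurableSet (Prod.mk ω ⁻¹' S.detectSet e c) := fun c =>
      measurable_prodMk_left (S.measurableSet_detectSet e c)
    simp only [f, g]
    rw [Measure.restrict_apply (hm 1), Measure.restrict_apply (hm 0),
      ← measure_preimage_add_right volume (-y)
        (Prod.mk ω ⁻¹' S.detectSet e 0 ∩ cube k (a - 1) (b + 1))]
    refine measure_mono ?_
    rintro x ⟨hx, hxa, hxb⟩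
    have hxy : ∀ s, a - 1 ≤ x s - y s ∧ x s - y s ≤ b + 1 := by
      intro s
      have h1 := abs_le.mp (hy1 s)
      have h2 : a ≤ x s := hxa s
      have h3 : x s ≤ b := hxb s
      constructor <;> linarith
    rw [Set.mem_preimage, ← sub_eq_add_neg]
    refine ⟨?_, fun s => (hxy s).1, fun s => (hxy s).2⟩
    have hx' : S.output (testGraph e 1 x) ω e ≠ 0 := hx
    rw [S.output_one_eq_output_zero hker hcore hye
      (fun s => by have : a ≤ x s := hxa s; linarith)
      (fun s => by linarith [(hxy s).1])] at hx'
    exact hx'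
  calc ∑ e ∈ coreSlots k, f e
      = ∑ e ∈ coreSlots k with f e ≤ g e, f e + ∑ e ∈ coreSlots k with ¬ f e ≤ g e, f e :=
        (Finset.sum_filter_add_sum_filter_not _ _ _).symm
    _ ≤ ∑ e ∈ coreSlots k, g e + N * volume (cube k a b) := by
        gcongr
        · exact (Finset.sum_le_sum fun e he => (Finset.mem_filter.mp he).2).trans
            (Finset.sum_le_sum_of_subset (Finset.filter_subset _ _))
        · refine (Finset.sum_le_card_nsmul _ _ _ fun e _ => hf e).trans ?_
          rw [nsmul_eq_mul]
          gcongr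

variable {P : Measure Ω} {t : ℝ → ℝ} {S : LinearSketch (k + 2) N Ω}

theorem ComputesSpanner.le_measure_detect_one {p : ℝ} (hS : S.ComputesSpanner P t p)
    {e : EdgeSlot (k + 2)} (he : e ∈ coreSlots k) (hcard : 1 < (coreSlots k).card) {L U : ℝ}
    (hL : 1 ≤ L) (ht : ∀ r, L ≤ r → r ≤ U → t r < L) {x : EdgeSlot (k + 2) → ℝ}
    (hx : x ∈ cube k L U) :
    ENNReal.ofReal p ≤ P ((fun ω => (ω, x)) ⁻¹' S.detectSet e 1) := by
  have hxL : ∀ f, L ≤ x f := hx.1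
  have hxU : ∀ f, x f ≤ U := hx.2
  have hU : 1 ≤ U := hL.trans ((hxL e).trans (hxU e))
  have h := hS (testGraph e 1 x) (one_le_testGraph_wMax he) (testGraph_wMin_le he)
  refine (ENNReal.ofReal_le_of_le_toReal h).trans (measure_mono fun ω hω => ?_)
  rw [Set.mem_ofPred_eq, testGraph_wMin_eq he fun f => hL.trans (hxL f), NNReal.coe_one,
    div_one] at hω
  have hmax := testGraph_wMax_mem hcard hxL hxU hU (e := e)
  exact hω.testGraph_one_ne_zero he hxL (ht _ hmax.1 hmax.2) (by linarith)

theorem ComputesSpanner.measure_detect_zero_le [IsProbabilityMeasure P] {p : ℝ}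
    (hS : S.ComputesSpanner P t p)
    (hp : 0 ≤ p) {e : EdgeSlot (k + 2)} (he : e ∈ coreSlots k) (x : EdgeSlot (k + 2) → ℝ) :
    P ((fun ω => (ω, x)) ⁻¹' S.detectSet e 0) ≤ ENNReal.ofReal (1 - p) := by
  have h := hS (testGraph e 0 x) (one_le_testGraph_wMax he) (testGraph_wMin_le he)
  have hm : MeasurableSet ((fun ω => (ω, x)) ⁻¹' S.detectSet e 0) :=
    measurable_prodMk_right (S.measurableSet_detectSet e 0)
  rw [← compl_compl ((fun ω => (ω, x)) ⁻¹' S.detectSet e 0), prob_compl_eq_one_sub hm.compl,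
    ENNReal.ofReal_sub _ hp, ENNReal.ofReal_one]
  refine tsub_le_tsub_left
    ((ENNReal.ofReal_le_of_le_toReal h).trans (measure_mono fun ω hω => ?_)) _
  exact not_not.mpr hω.testGraph_zero_eq_zero

theorem ComputesSpanner.card_coreSlots_le [IsProbabilityMeasure P] {p : ℝ}
    (hS : S.ComputesSpanner P t p) (hp : 0 ≤ p)
    (hcard : 1 < (coreSlots k).card) {L U : ℝ}
    (hL : 1 ≤ L) (ht : ∀ r, L ≤ r → r ≤ U → t r < L) :
    (coreSlots k).card * (ENNReal.ofReal p * volume (cube k L U)) ≤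
      (coreSlots k).card * (ENNReal.ofReal (1 - p) * volume (cube k (L - 1) (U + 1))) +
        N * volume (cube k L U) := by
  have hswap : ∀ e c (A : Set (EdgeSlot (k + 2) → ℝ)),
      ∫⁻ ω, volume.restrict A (Prod.mk ω ⁻¹' S.detectSet e c) ∂P =
        ∫⁻ x in A, P ((fun ω => (ω, x)) ⁻¹' S.detectSet e c) := fun e c A => by
    rw [← Measure.prod_apply (S.measurableSet_detectSet e c),
      ← Measure.prod_apply_symm (S.measurableSet_detectSet e c)]
  have hmeas : ∀ e c (A : Set (EdgeSlot (k + 2) → ℝ)),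
      Measurable fun ω => volume.restrict A (Prod.mk ω ⁻¹' S.detectSet e c) := fun e c A =>
    measurable_measure_prodMk_left (S.measurableSet_detectSet e c)
  calc (coreSlots k).card * (ENNReal.ofReal p * volume (cube k L U))
      = ∑ e ∈ coreSlots k, ENNReal.ofReal p * volume (cube k L U) := by
        rw [Finset.sum_const, nsmul_eq_mul]
    _ ≤ ∑ e ∈ coreSlots k,
          ∫⁻ ω, volume.restrict (cube k L U) (Prod.mk ω ⁻¹' S.detectSet e 1) ∂P := by
        refine Finset.sum_le_sum fun e he => ?_
        rw [hswap, ← setLIntegral_const]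
        exact setLIntegral_mono' measurableSet_Icc fun x hx =>
          hS.le_measure_detect_one he hcard hL ht hx
    _ = ∫⁻ ω, ∑ e ∈ coreSlots k,
          volume.restrict (cube k L U) (Prod.mk ω ⁻¹' S.detectSet e 1) ∂P :=
        (lintegral_finsetSum _ fun e _ => hmeas e 1 _).symm
    _ ≤ ∫⁻ ω, (∑ e ∈ coreSlots k,
          volume.restrict (cube k (L - 1) (U + 1)) (Prod.mk ω ⁻¹' S.detectSet e 0)) +
            N * volume (cube k L U) ∂P :=
        lintegral_mono fun ω => S.sum_volume_detect_le ω hL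
    _ = (∑ e ∈ coreSlots k,
          ∫⁻ ω, volume.restrict (cube k (L - 1) (U + 1)) (Prod.mk ω ⁻¹' S.detectSet e 0) ∂P) +
            N * volume (cube k L U) := by
        rw [lintegral_add_right _ measurable_const, lintegral_const, measure_univ, mul_one,
          lintegral_finsetSum _ fun e _ => hmeas e 0 _]
    _ ≤ (∑ e ∈ coreSlots k, ENNReal.ofReal (1 - p) * volume (cube k (L - 1) (U + 1))) +
            N * volume (cube k L U) := by
        gcongr with e he
        rw [hswap, ← setLIntegral_const]
        exact setLIntegral_mono' measurableSet_Icc fun x _ =>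
          hS.measure_detect_zero_le hp he x
    _ = _ := by rw [Finset.sum_const, nsmul_eq_mul]

theorem ComputesSpanner.card_coreSlots_le_real [IsProbabilityMeasure P] {p : ℝ}
    (hS : S.ComputesSpanner P t p)
    (hp : 0 ≤ p) (hp1 : p ≤ 1) (hcard : 1 < (coreSlots k).card) {L : ℝ}
    (hL : 1 ≤ L) (ht : ∀ r, L ≤ r → r ≤ 2 * L → t r < L)
    (hvol : (L + 2) ^ Fintype.card (EdgeSlot (k + 2)) ≤
      2 * L ^ Fintype.card (EdgeSlot (k + 2))) :
    (coreSlots k).card * p ≤ (coreSlots k).card * (2 * (1 - p)) + N := by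
  have h := hS.card_coreSlots_le hp hcard hL ht
  set m := Fintype.card (EdgeSlot (k + 2))
  have hL0 : 0 < L := by linarith
  have hp1' : 0 ≤ 1 - p := by linarith
  rw [volume_cube, volume_cube, show 2 * L - L = L by ring,
    show 2 * L + 1 - (L - 1) = L + 2 by ring, ← ENNReal.ofReal_pow hL0.le,
    ← ENNReal.ofReal_pow (by linarith), ← ENNReal.ofReal_natCast, ← ENNReal.ofReal_natCast (n := N),
    ← ENNReal.ofReal_mul hp, ← ENNReal.ofReal_mul hp1', ← ENNReal.ofReal_mul (by positivity),
    ← ENNReal.ofReal_mul (by positivity), ← ENNReal.ofReal_mul (by positivity),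
    ← ENNReal.ofReal_add (by positivity) (by positivity),
    ENNReal.ofReal_le_ofReal_iff (by positivity)] at h
  refine le_of_mul_le_mul_right ?_ (pow_pos hL0 m)
  have : (coreSlots k).card * ((1 - p) * (L + 2) ^ m) ≤
      (coreSlots k).card * ((1 - p) * (2 * L ^ m)) := by gcongr
  linarith

end LinearSketch

theorem eventually_add_pow_le_two_mul_pow (a : ℝ) (m : ℕ) :
    ∀ᶠ L : ℝ in Filter.atTop, (L + a) ^ m ≤ 2 * L ^ m := by
  have h1 : Filter.Tendsto (fun L : ℝ => (1 + a / L) ^ m) Filter.atTop (nhds 1) := by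
    simpa using ((tendsto_const_nhds (x := (1 : ℝ))).add
      ((tendsto_const_nhds (x := a)).div_atTop Filter.tendsto_id)).pow m
  filter_upwards [h1.eventually (gt_mem_nhds one_lt_two), Filter.eventually_gt_atTop 0]
    with L h2 hL
  have h3 : L + a = (1 + a / L) * L := by field_simp
  rw [h3, mul_pow]
  gcongr

theorem proposition1p3 :
    ∃ ε c : ℝ, 0 < ε ∧ 0 < c ∧ ∃ n₀ : ℕ, ∀ n : ℕ, n₀ ≤ n →
      ∀ t : ℝ → ℝ, (∀ r, 1 ≤ r → 1 ≤ t r) → (∀ᶠ r in Filter.atTop, t r ≤ ε * r) →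
        ∀ (N : ℕ) (Ω : Type*) [MeasurableSpace Ω] (P : MeasureTheory.Measure Ω)
          [MeasureTheory.IsProbabilityMeasure P] (S : LinearSketch n N Ω),
          S.ComputesSpanner P t 0.9 → c * (n : ℝ) ^ 2 ≤ N := by
  refine ⟨1 / 3, 1 / 10, by norm_num, by norm_num, 10, ?_⟩
  intro n hn t _ ht N Ω _ P _ S hS
  obtain ⟨k, rfl⟩ : ∃ k, n = k + 2 := ⟨n - 2, by omega⟩
  obtain ⟨R, hR⟩ := Filter.eventually_atTop.mp ht
  obtain ⟨L, ⟨hvol, hL1⟩, hLR⟩ :=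
    (((eventually_add_pow_le_two_mul_pow 2 (Fintype.card (EdgeSlot (k + 2)))).and
      (Filter.eventually_ge_atTop 1)).and (Filter.eventually_ge_atTop R)).exists
  have hchoose : ((coreSlots k).card : ℝ) = k * (k - 1) / 2 := by
    rw [card_coreSlots, Nat.cast_choose_two]
  have hk : (8 : ℝ) ≤ k := by exact_mod_cast (by omega : 8 ≤ k)
  have hcard : 1 < (coreSlots k).card := by
    have : (1 : ℝ) < (coreSlots k).card := by
      rw [hchoose]
      nlinarith
    exact_mod_cast this
  have h := hS.card_coreSlots_le_real (by norm_num) (by norm_num) hcard hL1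
    (fun r h1 h2 => by linarith [hR r (hLR.trans h1)]) hvol
  rw [hchoose] at h
  push_cast
  nlinarith
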